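/- **Setting.** Let $\mathcal G=(\mathcal V,\mathcal E)$ be a connected graph on the sensors $\mathcal V=\{1,\dots,n\}$, each edge carrying a fixed direction $i\to j$. Let $a_1,\dots,a_m\in\mathbb R^p$ be anchor positions and $\mathcal A_i\subseteq\{1,\dots,m\}$ the anchors with a range measurement to sensor $i$; at least one $\mathcal A_i$ is non-empty. Let $d_{ij}\ge 0$, $r_{ik}\ge 0$ be the measured ranges and $D_{ij}>0$, $R_{ik}>0$ the Huber radii ($i\sim j\in\mathcal E$, $k\in\mathcal A_i$), and let $h_\delta(u)=u^2$ for $|u|\le\delta$, $h_\delta(u)=2\delta|u|-\delta^2$ for $|u|\ge\delta$. For $z=(x,y,w)$, with $x=(x_i)$, $y=(y_{ij})_{i\sim j}$, $w=(w_{ik})_{k\in\mathcal A_i}$ all with components in $\mathbb R^p$, put $$F(z)=\sum_{i\sim j}\tfrac12 h_{D_{ij}}(\|x_i-x_j-y_{ij}\|)+\sum_i\sum_{k\in\mathcal A_i}\tfrac12 h_{R_{ik}}(\|x_i-a_k-w_{ik}\|),$$ $$\mathcal Z=\{z:\ \|y_{ij}\|\le d_{ij},\ \|w_{ik}\|\le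 r_{ik}\},\qquad F^\star=\inf_{z\in\mathcal Z}F(z).$$ The asynchronous algorithm starts at some $z^0\in\mathcal Z$. At iteration $t=1,2,\dots$ one random sensor $\chi_t$ wakes up, where the $\chi_t$ are independent with $\mathbb P(\chi_t=i)=P_i>0$. If $\chi_t=i$, then $z^t$ is obtained from $z^{t-1}$ by minimizing $F$ over $\mathcal Z$ with respect to the block of sensor $i$, consisting of $x_i$, the $y$-variables of all edges incident to $i$, and $w_{ik}$, $k\in\mathcal A_i$, all other variables being kept fixed (if there are several minimizers, any one may be taken, provided the choice does not depend on future wake-ups). Let $F_i^\star(z)$ be the minimal value of $F$ so obtained from $z$, and let $\varphi(z)=\sum_{i}P_i\,(F(z)-F_i^\star(z))$ be the expected improvement at $z$. **Theorem.** Let $\varepsilon>0$, and let $$b_\varepsilon=\inf\{\varphi(z):\ z\in\mathcal Z,\ F^\star+\varepsilon<F(z)\le F(z^0)\},$$ with $b_\varepsilon=+\infty$ if this set is empty. Then $b_\varepsilon>0$, and $b_\varepsilon<\infty$ whenever $F(z^0)>F^\star+\varepsilon$. Let $K_\varepsilon\in\{0,1,2,\dots,\infty\}$ be the first $t$ with $F(z^t)\le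 F^\star+\varepsilon$. Then $K_\varepsilon$ is a random variable that is finite almost surely, $F(z^t)\le F^\star+\varepsilon$ for all $t\ge K_\varepsilon$, and $$\mathbb E[K_\varepsilon]\le\frac{F(z^0)-F^\star}{b_\varepsilon}<\infty .$$ -/

import Mathlib

open MeasureTheory ProbabilityTheory
open scoped ENNReal

noncomputable section

/-- The Huber loss with radius `δ`. -/
def huber (δ u : ℝ) : ℝ :=
  if |u| ≤ δ then u ^ 2 else 2 * δ * |u| - δ ^ 2

/-- The data of a localization problem in `ℝ^p` with sensors `Fin n` and anchors `Fin m`. -/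
structure LocNetwork (n m p : ℕ) where
  /-- the measurement graph on the sensors -/
  G : SimpleGraph (Fin n)
  /-- the edges, each with the direction agreed on by its two end nodes -/
  arcs : Finset (Fin n × Fin n)
  adj_iff : ∀ i j, G.Adj i j ↔ ((i, j) ∈ arcs ∨ (j, i) ∈ arcs)
  arcs_asymm : ∀ i j, (i, j) ∈ arcs → (j, i) ∉ arcs
  /-- the set of anchors with a measured range to a given sensor -/
  anchorsOf : Fin n → Finset (Fin m)
  /-- the anchor positions -/
  a : Fin m → EuclideanSpace ℝ (Fin p)
  /-- the range measurements between sensors -/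
  d : {e : Fin n × Fin n // e ∈ arcs} → ℝ
  /-- the Huber radii of the inter-sensor terms -/
  D : {e : Fin n × Fin n // e ∈ arcs} → ℝ
  /-- the range measurements between sensors and anchors -/
  r : {q : Fin n × Fin m // q.2 ∈ anchorsOf q.1} → ℝ
  /-- the Huber radii of the sensor-anchor terms -/
  R : {q : Fin n × Fin m // q.2 ∈ anchorsOf q.1} → ℝ
  d_nonneg : ∀ e, 0 ≤ d e
  D_pos : ∀ e, 0 < D e
  r_nonneg : ∀ q, 0 ≤ r q
  R_pos : ∀ q, 0 < R q

namespace LocNetwork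

variable {n m p : ℕ}

/-- The edges, as an index type. -/
abbrev Arc (N : LocNetwork n m p) : Type := {e : Fin n × Fin n // e ∈ N.arcs}

/-- The pairs (sensor, anchor) with a measured range, as an index type. -/
abbrev Link (N : LocNetwork n m p) : Type := {q : Fin n × Fin m // q.2 ∈ N.anchorsOf q.1}

/-- The aggregated variable `z = (x, y, w)`. -/
abbrev State (N : LocNetwork n m p) : Type :=
  (Fin n → EuclideanSpace ℝ (Fin p)) × (N.Arc → EuclideanSpace ℝ (Fin p)) ×
    (N.Link → EuclideanSpace ℝ (Fin p))

/-- The cost `F(x, y, w)`. -/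
def cost (N : LocNetwork n m p) (z : N.State) : ℝ :=
  ∑ e : N.Arc, 1 / 2 * huber (N.D e) ‖z.1 e.1.1 - z.1 e.1.2 - z.2.1 e‖ +
    ∑ q : N.Link, 1 / 2 * huber (N.R q) ‖z.1 q.1.1 - N.a q.1.2 - z.2.2 q‖

/-- The constraint set. -/
def feasible (N : LocNetwork n m p) : Set N.State :=
  {z | (∀ e, ‖z.2.1 e‖ ≤ N.d e) ∧ (∀ q, ‖z.2.2 q‖ ≤ N.r q)}

/-- The optimal value `F*` of the cost over the constraint set. -/
def optValue (N : LocNetwork n m p) : ℝ :=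
  sInf (N.cost '' N.feasible)

/-- The feasible points that differ from `z` at most in the block of sensor `i`: its position
`x i`, the variables `y` of the edges incident to `i`, and the variables `w` of its anchors. -/
def slice (N : LocNetwork n m p) (i : Fin n) (z : N.State) : Set N.State :=
  {u | u ∈ N.feasible ∧
    (∀ j, j ≠ i → u.1 j = z.1 j) ∧
    (∀ e : N.Arc, e.1.1 ≠ i → e.1.2 ≠ i → u.2.1 e = z.2.1 e) ∧
    (∀ q : N.Link, q.1.1 ≠ i → u.2.2 q = z.2.2 q)}

/-- `u` results from `z` by an update of sensor `i`: it minimizes the cost over the block of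
sensor `i`, all other variables being fixed at their values in `z`. -/
def IsUpdate (N : LocNetwork n m p) (i : Fin n) (z u : N.State) : Prop :=
  u ∈ N.slice i z ∧ ∀ v ∈ N.slice i z, N.cost u ≤ N.cost v

/-- The least cost `F_i*(z)` that an update of sensor `i` can reach from `z`. -/
def blockMin (N : LocNetwork n m p) (i : Fin n) (z : N.State) : ℝ :=
  sInf (N.cost '' N.slice i z)

/-- The expected decrease of the cost in one iteration from `z`, when sensor `i` wakes up with
probability `P i`. -/
def expectedImprovement (N : LocNetwork n m p) (P : Fin n → ℝ) (z : N.State) : ℝ :=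
  ∑ i, (N.cost z - N.blockMin i z) * P i

/-- The feasible points of cost at most `F* + ε`. -/
def nearOptimal (N : LocNetwork n m p) (ε : ℝ) : Set N.State :=
  {z | z ∈ N.feasible ∧ N.cost z ≤ N.optValue + ε}

/-- The constant `b_ε`: the infimum of the expected improvement over the feasible points of cost
more than `F* + ε` and at most the initial cost (`⊤` if there is no such point). -/
def improvementBound (N : LocNetwork n m p) (P : Fin n → ℝ) (z₀ : N.State) (ε : ℝ) : ℝ≥0∞ :=
  ⨅ z ∈ {z : N.State | z ∈ N.feasible ∧ z ∉ N.nearOptimal ε ∧ N.cost z ≤ N.cost z₀},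
    ENNReal.ofReal (N.expectedImprovement P z)

/-- `Z` is the sequence of iterates of the asynchronous algorithm, started at `z₀`, when sensor
`χ t` is awake at iteration `t = 1, 2, …`. The `χ t` are independent with
`ℙ(χ t = i) = P i`. The `σ`-algebra `ℱ t` holds what is known after `t` iterations: the choice
between several minimizers may use the past and extra randomness, but not future wake-ups. -/
structure IsAsyncRun (N : LocNetwork n m p) {Ω : Type*} {mΩ : MeasurableSpace Ω}
    (μ : Measure Ω) (ℱ : Filtration ℕ mΩ) (P : Fin n → ℝ) (z₀ : N.State)
    (χ : ℕ → Ω → Fin n) (Z : ℕ → Ω → N.State) : Prop where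
  measurable_χ : ∀ t, Measurable[ℱ (t + 1)] (χ (t + 1))
  measurable_Z : ∀ t, Measurable[ℱ t] (Z t)
  indep : ∀ t, Indep (MeasurableSpace.comap (χ (t + 1)) inferInstance) (ℱ t) μ
  law : ∀ t i, μ {ω | χ (t + 1) ω = i} = ENNReal.ofReal (P i)
  init : ∀ ω, Z 0 ω = z₀
  step : ∀ t ω, N.IsUpdate (χ (t + 1) ω) (Z t ω) (Z (t + 1) ω)

/-- The number `K_ε` of iterations until the iterates first have cost at most `F* + ε`
(`⊤` if that never happens). -/
def iterCount (N : LocNetwork n m p) {Ω : Type*} (Z : ℕ → Ω → N.State) (ε : ℝ) (ω : Ω) : ℕ∞ :=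
  ⨅ t ∈ {t : ℕ | Z t ω ∈ N.nearOptimal ε}, (t : ℕ∞)

end LocNetwork

end

/-! Each term of the cost lies above its tangent at every point and below that tangent plus half the
squared increment of the residual. The constraints bound each auxiliary variable separately. Hence,
if no single-sensor update improves a feasible point, the derivative is nonnegative on each block
part of a feasible direction and so on their sum; the tangent bound then gives optimality
(`cost_le_optValue`). Connectedness and one anchor link make the sublevel sets compact. Above level
`F* + ε` some block improves strictly, and by continuity the same replacement block improves all
nearby points; a finite cover gives `b_ε > 0` (`exists_le_expectedImprovement`). Wake-ups are
independent of the past, so the mean decrease at each step is at least `b_ε` times the probability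
of not yet being near-optimal (`mul_measure_le_lintegral`). These decreases telescope to at most
`F(z⁰) - F*`, while the probabilities dominate the mean of `K_ε`. -/

/-! ### The Huber loss: tangent minorant and quadratic majorant -/

theorem continuous_huber (δ : ℝ) : Continuous (huber δ) := by
  unfold huber
  refine Continuous.if_le (by fun_prop) (by fun_prop) (by fun_prop) (by fun_prop) fun u hu => ?_
  rw [← sq_abs, hu]; ring

/-- Dual form of the loss: it is the supremum of these expressions over `c ≤ δ`, attained at `c =
min |u| δ`. -/
theorem two_mul_sub_sq_le_huber {δ c u : ℝ} (hc : c ≤ δ) : 2 * c * |u| - c ^ 2 ≤ huber δ u := by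
  unfold huber
  split_ifs with h
  · nlinarith [sq_nonneg (c - |u|), sq_abs u]
  · nlinarith

theorem huber_nonneg (δ u : ℝ) (hδ : 0 ≤ δ) : 0 ≤ huber δ u := by
  simpa using two_mul_sub_sq_le_huber (u := u) hδ

/-- Infimal-convolution form: part of `u` is charged quadratically and the rest linearly, the best
split being `a = min u δ`. -/
theorem huber_le_sq_add {δ u a b : ℝ} (hδ : 0 ≤ δ) (hu : 0 ≤ u) (hb : 0 ≤ b) (h : u ≤ a + b) :
    huber δ u ≤ a ^ 2 + 2 * δ * b := by
  unfold huber
  rw [abs_of_nonneg hu]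
  split_ifs with h'
  · nlinarith [sq_nonneg (u - a), mul_le_mul_of_nonneg_right h' hb, mul_le_mul_of_nonneg_left h hu]
  · nlinarith [sq_nonneg (δ - a)]

section InnerProductSpace

variable {E : Type*} [NormedAddCommGroup E] [InnerProductSpace ℝ E]

/-- The gradient at `v` of half the Huber loss of the norm: the projection of `v` onto the ball
of radius `δ`. -/
noncomputable def huberGrad (δ : ℝ) (v : E) : E :=
  if ‖v‖ ≤ δ then v else (δ / ‖v‖) • v

theorem half_huber_add_inner_le {δ : ℝ} (hδ : 0 < δ) (v e : E) :
    1 / 2 * huber δ ‖v‖ + inner ℝ (huberGrad δ v) e ≤ 1 / 2 * huber δ ‖v + e‖ := by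
  -- Every `g` in the `δ`-ball gives an affine minorant; `g = huberGrad δ v` makes it exact at `e =
  -- 0`.
  have key : ∀ g : E, ‖g‖ ≤ δ → inner ℝ g (v + e) - 1 / 2 * ‖g‖ ^ 2 ≤ 1 / 2 * huber δ ‖v + e‖ := by
    intro g hg
    have h1 := real_inner_le_norm g (v + e)
    have h2 := two_mul_sub_sq_le_huber (u := ‖v + e‖) hg
    rw [abs_norm] at h2
    linarith
  unfold huberGrad
  split_ifs with h
  · refine le_trans (le_of_eq ?_) (key v h)
    rw [huber, if_pos (by simpa using h), inner_add_right, real_inner_self_eq_norm_sq]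
    ring
  · have hv : 0 < ‖v‖ := hδ.trans (not_le.1 h)
    have hn : ‖(δ / ‖v‖) • v‖ = δ := by
      rw [norm_smul, Real.norm_of_nonneg (by positivity)]; field_simp
    refine le_trans (le_of_eq ?_) (key _ hn.le)
    rw [huber, if_neg (by simpa using h), hn, inner_add_right, real_inner_smul_left,
      real_inner_smul_left, real_inner_self_eq_norm_sq, abs_norm]
    field_simp
    ring

theorem half_huber_add_le {δ : ℝ} (hδ : 0 < δ) (v e : E) :
    1 / 2 * huber δ ‖v + e‖ ≤
      1 / 2 * huber δ ‖v‖ + inner ℝ (huberGrad δ v) e + 1 / 2 * ‖e‖ ^ 2 := by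
  -- Used with `g` the projection of `v` onto the ball and `s` the remainder: only `g + e` is
  -- charged quadratically.
  have key : ∀ g s : E, v = g + s → huber δ ‖v + e‖ ≤ ‖g + e‖ ^ 2 + 2 * δ * ‖s‖ := fun g s hs =>
    huber_le_sq_add hδ.le (norm_nonneg _) (norm_nonneg _) (by
      rw [hs, add_right_comm]; exact norm_add_le _ _)
  unfold huberGrad
  split_ifs with h
  · have h1 := key v 0 (by simp)
    rw [norm_add_sq_real] at h1
    rw [huber.eq_1 δ ‖v‖, if_pos (by simpa using h)]
    simp at h1
    linarith
  · have hv : 0 < ‖v‖ := hδ.trans (not_le.1 h)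
    have hn : ‖(δ / ‖v‖) • v‖ = δ := by
      rw [norm_smul, Real.norm_of_nonneg (by positivity)]; field_simp
    have hs : ‖(1 - δ / ‖v‖) • v‖ = ‖v‖ - δ := by
      have : δ / ‖v‖ ≤ 1 := (div_le_one hv).2 (not_le.1 h).le
      rw [norm_smul, Real.norm_of_nonneg (by linarith)]; field_simp
    have h1 := key ((δ / ‖v‖) • v) ((1 - δ / ‖v‖) • v) (by rw [← add_smul]; simp)
    rw [norm_add_sq_real, hs, hn] at h1
    rw [huber.eq_1 δ ‖v‖, if_neg (by simpa using h), abs_norm]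
    linarith

end InnerProductSpace

/-! ### First-order bounds for the cost -/

namespace LocNetwork

variable {n m p : ℕ} (N : LocNetwork n m p)

noncomputable section

/-- The Huber radius of a term of the cost. -/
def radius : N.Arc ⊕ N.Link → ℝ := Sum.elim N.D N.R

theorem radius_pos (k : N.Arc ⊕ N.Link) : 0 < N.radius k := by
  cases k
  · exact N.D_pos _
  · exact N.R_pos _

/-- The linear part of the residual of a term of the cost. -/
def linRes (k : N.Arc ⊕ N.Link) : N.State →ₗ[ℝ] EuclideanSpace ℝ (Fin p) :=
  k.elim
    (fun e => { toFun := fun z => z.1 e.1.1 - z.1 e.1.2 - z.2.1 e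
                map_add' := fun z z' => by simp; abel
                map_smul' := fun c z => by simp [smul_sub] })
    (fun q => { toFun := fun z => z.1 q.1.1 - z.2.2 q
                map_add' := fun z z' => by simp; abel
                map_smul' := fun c z => by simp [smul_sub] })

/-- The residual of a term of the cost. -/
def res (k : N.Arc ⊕ N.Link) (z : N.State) : EuclideanSpace ℝ (Fin p) :=
  N.linRes k z - Sum.elim (fun _ => 0) (fun q => N.a q.1.2) k

theorem res_add (k : N.Arc ⊕ N.Link) (z v : N.State) :
    N.res k (z + v) = N.res k z + N.linRes k v := by
  simp only [res, map_add]; abel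

theorem cost_eq (z : N.State) :
    N.cost z = ∑ k, 1 / 2 * huber (N.radius k) ‖N.res k z‖ := by
  rw [Fintype.sum_sum_type, cost]
  congr 1
  · simp [res, linRes, radius]
  · refine Finset.sum_congr rfl fun q _ => ?_
    simp only [res, linRes, radius, Sum.elim_inr, LinearMap.coe_mk, AddHom.coe_mk]
    rw [sub_right_comm]

theorem term_nonneg (k : N.Arc ⊕ N.Link) (z : N.State) :
    0 ≤ 1 / 2 * huber (N.radius k) ‖N.res k z‖ :=
  mul_nonneg (by norm_num) (huber_nonneg _ _ (N.radius_pos k).le)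

theorem cost_nonneg (z : N.State) : 0 ≤ N.cost z := by
  rw [cost_eq]; exact Finset.sum_nonneg fun k _ => N.term_nonneg k z

theorem continuous_cost : Continuous N.cost := by
  unfold cost
  refine .add (continuous_finsetSum _ fun e _ => ?_) (continuous_finsetSum _ fun q _ => ?_)
  · exact continuous_const.mul ((continuous_huber _).comp (by fun_prop))
  · exact continuous_const.mul ((continuous_huber _).comp (by fun_prop))

/-- The derivative of the cost at `z`. -/
def costDeriv (z : N.State) : N.State →ₗ[ℝ] ℝ :=
  ∑ k, (innerₗ _ (huberGrad (N.radius k) (N.res k z))) ∘ₗ N.linRes k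

theorem cost_add_costDeriv_le (z v : N.State) :
    N.cost z + N.costDeriv z v ≤ N.cost (z + v) := by
  simp only [cost_eq, costDeriv, LinearMap.sum_apply, ← Finset.sum_add_distrib, res_add]
  exact Finset.sum_le_sum fun k _ => half_huber_add_inner_le (N.radius_pos k) _ _

theorem cost_add_le (z v : N.State) :
    N.cost (z + v) ≤ N.cost z + N.costDeriv z v + ∑ k, 1 / 2 * ‖N.linRes k v‖ ^ 2 := by
  simp only [cost_eq, costDeriv, LinearMap.sum_apply, ← Finset.sum_add_distrib, res_add]
  exact Finset.sum_le_sum fun k _ => half_huber_add_le (N.radius_pos k) _ _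

theorem costDeriv_nonneg {z v : N.State}
    (h : ∀ t : ℝ, 0 < t → t ≤ 1 → N.cost z ≤ N.cost (z + t • v)) : 0 ≤ N.costDeriv z v := by
  by_contra! hneg
  set c := ∑ k, 1 / 2 * ‖N.linRes k v‖ ^ 2 with hc
  have hc0 : 0 ≤ c := Finset.sum_nonneg fun k _ => by positivity
  set D := N.costDeriv z v
  have key : ∀ t : ℝ, 0 < t → t ≤ 1 → 0 ≤ D + t * c := by
    intro t ht ht1
    have h1 := (h t ht ht1).trans (N.cost_add_le z (t • v))
    have h2 : ∑ k, 1 / 2 * ‖N.linRes k (t • v)‖ ^ 2 = t ^ 2 * c := by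
      rw [hc, Finset.mul_sum]
      refine Finset.sum_congr rfl fun k _ => ?_
      rw [map_smul, norm_smul, mul_pow, Real.norm_eq_abs, sq_abs]; ring
    rw [h2, map_smul, smul_eq_mul] at h1
    have : 0 ≤ t * (D + t * c) := by linarith
    exact nonneg_of_mul_nonneg_right this ht
  -- At this step size `t * c ≤ -D / 2`, so `D + t * c ≤ D / 2 < 0`; the `+ 1` covers `c = 0`.
  have h2 := key (min 1 (-D / (2 * (c + 1)))) (by
    have : 0 < -D / (2 * (c + 1)) := div_pos (by linarith) (by linarith)
    exact lt_min one_pos this) (min_le_left _ _)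
  have h3 : min 1 (-D / (2 * (c + 1))) * c ≤ -D / (2 * (c + 1)) * c :=
    mul_le_mul_of_nonneg_right (min_le_right _ _) hc0
  have h4 : -D / (2 * (c + 1)) * c ≤ -D / 2 := by
    rw [div_mul_eq_mul_div, div_le_div_iff₀ (by linarith) two_pos]
    nlinarith
  linarith

/-! ### Blocks -/

/-- The state that agrees with `v` on the block of sensor `i` and with `z` elsewhere. -/
def graft (i : Fin n) (z v : N.State) : N.State :=
  (fun j => if j = i then v.1 j else z.1 j,
    fun e => if e.1.1 = i ∨ e.1.2 = i then v.2.1 e else z.2.1 e,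
    fun q => if q.1.1 = i then v.2.2 q else z.2.2 q)

variable {N}

theorem graft_mem_slice {i : Fin n} {z v : N.State} (hz : z ∈ N.feasible) (hv : v ∈ N.feasible) :
    N.graft i z v ∈ N.slice i z := by
  refine ⟨⟨fun e => ?_, fun q => ?_⟩, fun j hj => ?_, fun e h1 h2 => ?_, fun q hq => ?_⟩
  · dsimp only [graft]
    split_ifs
    exacts [hv.1 e, hz.1 e]
  · dsimp only [graft]
    split_ifs
    exacts [hv.2 q, hz.2 q]
  · simp [graft, hj]
  · simp [graft, h1, h2]
  · simp [graft, hq]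

theorem graft_eq_of_mem_slice {i : Fin n} {z v : N.State} (hv : v ∈ N.slice i z) :
    N.graft i z v = v := by
  obtain ⟨-, h1, h2, h3⟩ := hv
  refine Prod.ext (funext fun j => ?_) (Prod.ext (funext fun e => ?_) (funext fun q => ?_))
  · by_cases h : j = i <;> simp [graft, h, h1]
  · by_cases h : e.1.1 = i ∨ e.1.2 = i
    · simp [graft, h]
    · simp only [graft, h, if_false]
      rw [not_or] at h
      exact (h2 e h.1 h.2).symm
  · by_cases h : q.1.1 = i
    · simp [graft, h]
    · simp [graft, h, h3]

theorem continuous_graft (i : Fin n) (v : N.State) : Continuous fun z => N.graft i z v := by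
  unfold graft
  refine .prodMk (continuous_pi fun j => ?_)
    (.prodMk (continuous_pi fun e => ?_) (continuous_pi fun q => ?_))
  all_goals split_ifs <;> fun_prop

theorem mem_slice_self {i : Fin n} {z : N.State} (hz : z ∈ N.feasible) : z ∈ N.slice i z :=
  ⟨hz, fun _ _ => rfl, fun _ _ _ => rfl, fun _ _ => rfl⟩

theorem bddBelow_cost_image (s : Set N.State) : BddBelow (N.cost '' s) :=
  ⟨0, by rintro _ ⟨z, -, rfl⟩; exact N.cost_nonneg z⟩

theorem blockMin_le {i : Fin n} {z v : N.State} (hv : v ∈ N.slice i z) :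
    N.blockMin i z ≤ N.cost v :=
  csInf_le (bddBelow_cost_image _) ⟨v, hv, rfl⟩

theorem optValue_le {z : N.State} (hz : z ∈ N.feasible) : N.optValue ≤ N.cost z :=
  csInf_le (bddBelow_cost_image _) ⟨z, hz, rfl⟩

theorem blockMin_le_cost (i : Fin n) {z : N.State} (hz : z ∈ N.feasible) :
    N.blockMin i z ≤ N.cost z :=
  blockMin_le (mem_slice_self hz)

/-- The part of `v` that belongs to sensor `i`, every edge variable being assigned to the tail
of the edge. -/
def blockPart (i : Fin n) (v : N.State) : N.State :=
  (fun j => if i = j then v.1 j else 0, fun e => if i = e.1.1 then v.2.1 e else 0,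
    fun q => if i = q.1.1 then v.2.2 q else 0)

/-- An edge variable lies in the blocks of both end nodes; attributing it to the tail alone counts
it exactly once. -/
theorem sum_blockPart (v : N.State) : ∑ i, blockPart i v = v := by
  refine Prod.ext (funext fun j => ?_) (Prod.ext (funext fun e => ?_) (funext fun q => ?_)) <;>
    simp [blockPart, Prod.fst_sum, Prod.snd_sum]

theorem norm_add_smul_sub_le {E : Type*} [NormedAddCommGroup E] [NormedSpace ℝ E] {a b : E}
    {c t : ℝ} (ha : ‖a‖ ≤ c) (hb : ‖b‖ ≤ c) (ht : 0 ≤ t) (ht1 : t ≤ 1) :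
    ‖a + t • (b - a)‖ ≤ c := by
  have := (convex_closedBall (0 : E) c).add_smul_sub_mem (x := a) (y := b) (t := t)
    (by simpa using ha) (by simpa using hb) ⟨ht, ht1⟩
  simpa using this

/-- The feasible set is a product of balls and free factors, so moving some components towards `v`
while freezing the others stays feasible. -/
theorem add_smul_blockPart_mem_slice {i : Fin n} {z v : N.State} (hz : z ∈ N.feasible)
    (hv : v ∈ N.feasible) {t : ℝ} (ht : 0 ≤ t) (ht1 : t ≤ 1) :
    z + t • blockPart i (v - z) ∈ N.slice i z := by
  refine ⟨⟨fun e => ?_, fun q => ?_⟩, fun j hj => ?_, fun e h1 h2 => ?_, fun q hq => ?_⟩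
  · by_cases h : i = e.1.1
    · simpa [blockPart, h] using norm_add_smul_sub_le (hz.1 e) (hv.1 e) ht ht1
    · simpa [blockPart, h] using hz.1 e
  · by_cases h : i = q.1.1
    · simpa [blockPart, h] using norm_add_smul_sub_le (hz.2 q) (hv.2 q) ht ht1
    · simpa [blockPart, h] using hz.2 q
  · simp [blockPart, hj.symm]
  · simp [blockPart, Ne.symm h1]
  · simp [blockPart, Ne.symm hq]

/-- A feasible state that no update can improve is optimal. -/
theorem cost_le_optValue {z : N.State} (hz : z ∈ N.feasible)
    (h : ∀ i, ∀ v ∈ N.slice i z, N.cost z ≤ N.cost v) : N.cost z ≤ N.optValue := by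
  refine le_csInf (Set.Nonempty.image _ ⟨z, hz⟩) ?_
  rintro _ ⟨v, hv, rfl⟩
  -- Linearity of the derivative is what lets blockwise optimality yield joint optimality.
  have h0 : 0 ≤ N.costDeriv z (v - z) := by
    rw [← sum_blockPart (v - z), map_sum]
    exact Finset.sum_nonneg fun i _ => N.costDeriv_nonneg fun t ht ht1 =>
      h i _ (add_smul_blockPart_mem_slice hz hv ht.le ht1)
  have := N.cost_add_costDeriv_le z (v - z)
  rw [add_sub_cancel] at this
  linarith

/-! ### Compactness of sublevel sets -/

theorem isClosed_feasible : IsClosed N.feasible := by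
  unfold feasible
  rw [Set.ofPred_and, Set.ofPred_forall, Set.ofPred_forall]
  refine .inter (isClosed_iInter fun e => ?_) (isClosed_iInter fun q => ?_)
  · exact isClosed_le (by fun_prop) continuous_const
  · exact isClosed_le (by fun_prop) continuous_const

/-- The loss grows at least linearly, `huber δ u ≥ 2δ|u| - δ²`, and no single term exceeds the total
cost. -/
theorem norm_res_le {z : N.State} {c : ℝ} (hc : N.cost z ≤ c) (k : N.Arc ⊕ N.Link) :
    ‖N.res k z‖ ≤ (2 * c + N.radius k ^ 2) / (2 * N.radius k) := by
  have h1 : 1 / 2 * huber (N.radius k) ‖N.res k z‖ ≤ N.cost z := by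
    rw [cost_eq]
    exact Finset.single_le_sum (f := fun k => 1 / 2 * huber (N.radius k) ‖N.res k z‖)
      (fun k _ => N.term_nonneg k z) (Finset.mem_univ k)
  have h2 := two_mul_sub_sq_le_huber (δ := N.radius k) (u := ‖N.res k z‖) le_rfl
  rw [abs_norm] at h2
  rw [le_div_iff₀ (by have := N.radius_pos k; linarith)]
  linarith

/-- An anchor link bounds the position of one sensor, each edge bounds the difference of its end
positions, and the bound propagates along a path. -/
theorem exists_norm_position_le (hconn : N.G.Connected) (hanchor : ∃ i, (N.anchorsOf i).Nonempty)
    (c : ℝ) (j : Fin n) : ∃ B, ∀ z ∈ N.feasible, N.cost z ≤ c → ‖z.1 j‖ ≤ B := by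
  obtain ⟨i, k, hk⟩ := hanchor
  have harc : ∀ e : N.Arc, ∃ B, ∀ z ∈ N.feasible, N.cost z ≤ c → ‖z.1 e.1.1 - z.1 e.1.2‖ ≤ B := by
    refine fun e => ⟨(2 * c + N.radius (.inl e) ^ 2) / (2 * N.radius (.inl e)) + N.d e,
      fun z hz hzc => ?_⟩
    have h1 := norm_res_le hzc (.inl e)
    have h2 := norm_add_le (N.res (.inl e) z) (z.2.1 e)
    have h3 : N.res (.inl e) z + z.2.1 e = z.1 e.1.1 - z.1 e.1.2 := by simp [res, linRes]
    rw [h3] at h2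
    exact h2.trans (add_le_add h1 (hz.1 e))
  induction (SimpleGraph.reachable_iff_reflTransGen i j).1 (hconn.preconnected i j) with
  | refl =>
    let q : N.Link := ⟨(i, k), hk⟩
    refine ⟨(2 * c + N.radius (.inr q) ^ 2) / (2 * N.radius (.inr q)) + N.r q + ‖N.a k‖,
      fun z hz hzc => ?_⟩
    have h1 := norm_res_le hzc (.inr q)
    have h2 := norm_add₃_le (a := N.res (.inr q) z) (b := z.2.2 q) (c := N.a k)
    have h3 : N.res (.inr q) z + z.2.2 q + N.a k = z.1 i := by
      simp [res, linRes, q]; abel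
    rw [h3] at h2
    exact h2.trans (add_le_add_left (add_le_add h1 (hz.2 q)) _)
  | @tail j l _ hjl ih =>
    obtain ⟨B, hB⟩ := ih
    rcases (N.adj_iff j l).1 hjl with h | h
    · obtain ⟨B', hB'⟩ := harc ⟨_, h⟩
      refine ⟨B + B', fun z hz hzc => ?_⟩
      have h2 := norm_sub_le (z.1 j) (z.1 j - z.1 l)
      rw [sub_sub_cancel] at h2
      exact h2.trans (add_le_add (hB z hz hzc) (hB' z hz hzc))
    · obtain ⟨B', hB'⟩ := harc ⟨_, h⟩
      refine ⟨B + B', fun z hz hzc => ?_⟩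
      have h2 := norm_add_le (z.1 j) (z.1 l - z.1 j)
      rw [add_sub_cancel] at h2
      exact h2.trans (add_le_add (hB z hz hzc) (hB' z hz hzc))

theorem isCompact_sublevel (hconn : N.G.Connected) (hanchor : ∃ i, (N.anchorsOf i).Nonempty)
    (c : ℝ) : IsCompact {z | z ∈ N.feasible ∧ N.cost z ≤ c} := by
  choose B hB using exists_norm_position_le hconn hanchor c
  refine IsCompact.of_isClosed_subset
    ((isCompact_univ_pi fun j => isCompact_closedBall (0 : EuclideanSpace ℝ (Fin p)) (B j)).prod
      ((isCompact_univ_pi fun e => isCompact_closedBall (0 : EuclideanSpace ℝ (Fin p)) (N.d e)).prod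
      (isCompact_univ_pi fun q => isCompact_closedBall (0 : EuclideanSpace ℝ (Fin p)) (N.r q))))
    (isClosed_feasible.inter (isClosed_le N.continuous_cost continuous_const)) ?_
  rintro z ⟨hz, hzc⟩
  simp only [Set.mem_prod, Set.mem_univ_pi, mem_closedBall_zero_iff]
  exact ⟨fun j => hB j z hz hzc, hz.1, hz.2⟩

/-! ### The expected improvement -/

theorem mul_sub_cost_le_expectedImprovement {P : Fin n → ℝ} (hP : ∀ i, 0 ≤ P i) {z v : N.State}
    (hz : z ∈ N.feasible) {i : Fin n} (hv : v ∈ N.slice i z) :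
    (N.cost z - N.cost v) * P i ≤ N.expectedImprovement P z := by
  refine le_trans ?_ (Finset.single_le_sum (f := fun i => (N.cost z - N.blockMin i z) * P i)
    (fun j _ => mul_nonneg (sub_nonneg.2 (blockMin_le_cost j hz)) (hP j)) (Finset.mem_univ i))
  exact mul_le_mul_of_nonneg_right (sub_le_sub_left (blockMin_le hv) _) (hP i)

/-- The non-strict inequality `F* + ε ≤ F(z)` keeps the region closed, hence compact; local positive
lower bounds then combine to a global one. -/
theorem exists_le_expectedImprovement (hconn : N.G.Connected)
    (hanchor : ∃ i, (N.anchorsOf i).Nonempty) {P : Fin n → ℝ} (hP : ∀ i, 0 < P i)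
    {ε : ℝ} (hε : 0 < ε) (c : ℝ) :
    ∃ b > 0, ∀ z ∈ N.feasible, N.optValue + ε ≤ N.cost z → N.cost z ≤ c →
      b ≤ N.expectedImprovement P z := by
  have hK : IsCompact ({z | z ∈ N.feasible ∧ N.cost z ≤ c} ∩ {z | N.optValue + ε ≤ N.cost z}) :=
    (isCompact_sublevel hconn hanchor c).inter_right
      (isClosed_le continuous_const N.continuous_cost)
  suffices h : ∃ b > 0, ∀ z ∈ {z | z ∈ N.feasible ∧ N.cost z ≤ c} ∩ {z | N.optValue + ε ≤ N.cost z},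
      b ≤ N.expectedImprovement P z by
    obtain ⟨b, hb, h⟩ := h
    exact ⟨b, hb, fun z h1 h2 h3 => h z ⟨⟨h1, h3⟩, h2⟩⟩
  refine hK.induction_on (p := fun s => ∃ b > 0, ∀ z ∈ s, b ≤ N.expectedImprovement P z)
    ⟨1, one_pos, by simp⟩ ?_ ?_ ?_
  · rintro s t hst ⟨b, hb, h⟩
    exact ⟨b, hb, fun z hz => h z (hst hz)⟩
  · rintro s t ⟨b, hb, h⟩ ⟨b', hb', h'⟩
    refine ⟨min b b', lt_min hb hb', ?_⟩
    rintro z (hz | hz)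
    · exact (min_le_left _ _).trans (h z hz)
    · exact (min_le_right _ _).trans (h' z hz)
  · rintro z ⟨⟨hz, hzc⟩, hzε⟩
    have : ∃ i, ∃ v ∈ N.slice i z, N.cost v < N.cost z := by
      by_contra! hcon
      have := cost_le_optValue hz hcon
      rw [Set.mem_ofPred_eq] at hzε
      linarith
    obtain ⟨i, v, hv, hlt⟩ := this
    set η := N.cost z - N.cost v with hη
    have hη0 : 0 < η := sub_pos.2 hlt
    -- Grafting the fixed block of `v` onto a nearby `u` still gains more than `η / 2`, so no
    -- continuity of `blockMin` is needed.
    have hcont : Continuous fun u => N.cost u - N.cost (N.graft i u v) :=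
      N.continuous_cost.sub (N.continuous_cost.comp (continuous_graft i v))
    have hev : ∀ᶠ u in nhds z, η / 2 < N.cost u - N.cost (N.graft i u v) := by
      refine (hcont.tendsto z).eventually_const_lt ?_
      rw [graft_eq_of_mem_slice hv, ← hη]
      linarith
    refine ⟨_, inter_mem_nhdsWithin _ hev, η / 2 * P i, mul_pos (half_pos hη0) (hP i), ?_⟩
    rintro u ⟨⟨⟨hu, -⟩, -⟩, hu'⟩
    exact (mul_le_mul_of_nonneg_right (le_of_lt hu') (hP i).le).trans
      (mul_sub_cost_le_expectedImprovement (fun i => (hP i).le) hu (graft_mem_slice hu hv.1))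

theorem improvementBound_pos (hconn : N.G.Connected) (hanchor : ∃ i, (N.anchorsOf i).Nonempty)
    {P : Fin n → ℝ} (hP : ∀ i, 0 < P i) (z₀ : N.State) {ε : ℝ} (hε : 0 < ε) :
    0 < N.improvementBound P z₀ ε := by
  obtain ⟨b, hb, h⟩ := exists_le_expectedImprovement hconn hanchor hP hε (N.cost z₀)
  refine (ENNReal.ofReal_pos.2 hb).trans_le (le_iInf₂ fun z hz => ?_)
  obtain ⟨h1, h2, h3⟩ := hz
  refine ENNReal.ofReal_le_ofReal (h z h1 ?_ h3)
  by_contra! hlt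
  exact h2 ⟨h1, hlt.le⟩

theorem improvementBound_lt_top {P : Fin n → ℝ} {z₀ : N.State} (hz₀ : z₀ ∈ N.feasible) {ε : ℝ}
    (h : N.optValue + ε < N.cost z₀) : N.improvementBound P z₀ ε < ⊤ :=
  (iInf₂_le z₀ ⟨hz₀, fun h' => h'.2.not_gt h, le_rfl⟩).trans_lt ENNReal.ofReal_lt_top

end

end LocNetwork

/-! ### Measurability, expected decrease and the iteration count -/

namespace LocNetwork

noncomputable section

variable {n m p : ℕ} {N : LocNetwork n m p}

instance borelSpace_state : BorelSpace N.State :=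
  haveI : BorelSpace ((N.Arc → EuclideanSpace ℝ (Fin p)) × (N.Link → EuclideanSpace ℝ (Fin p))) :=
    Prod.borelSpace
  Prod.borelSpace

/-- The decrease of the cost that an update of sensor `i` can reach from `z`, as a supremum of
continuous functions of `z`. -/
def gain (N : LocNetwork n m p) (i : Fin n) (z : N.State) : ℝ≥0∞ :=
  ⨆ v : N.feasible, ENNReal.ofReal (N.cost z - N.cost (N.graft i z v))

/-- A supremum of continuous functions, even an uncountable one, is lower semicontinuous and hence
Borel. -/
theorem measurable_gain (i : Fin n) : Measurable (N.gain i) := by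
  refine LowerSemicontinuous.measurable (lowerSemicontinuous_iSup fun v => ?_)
  exact (ENNReal.continuous_ofReal.comp (N.continuous_cost.sub
    (N.continuous_cost.comp (continuous_graft i v.1)))).lowerSemicontinuous

theorem gain_le {i : Fin n} {z u : N.State} (hz : z ∈ N.feasible) (hu : N.IsUpdate i z u) :
    N.gain i z ≤ ENNReal.ofReal (N.cost z - N.cost u) :=
  iSup_le fun v => ENNReal.ofReal_le_ofReal
    (sub_le_sub_left (hu.2 _ (graft_mem_slice hz v.2)) _)

theorem ofReal_sub_blockMin_le_gain {i : Fin n} {z : N.State} (hz : z ∈ N.feasible) :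
    ENNReal.ofReal (N.cost z - N.blockMin i z) ≤ N.gain i z := by
  -- Attainment of the block infimum is not used: an `η`-minimizer suffices.
  refine ENNReal.le_of_forall_pos_le_add fun η hη _ => ?_
  obtain ⟨_, ⟨v, hv, rfl⟩, hlt⟩ := Real.lt_sInf_add_pos
    (Set.Nonempty.image N.cost ⟨z, mem_slice_self (i := i) hz⟩) (NNReal.coe_pos.2 hη)
  have h1 : ENNReal.ofReal (N.cost z - N.cost v) ≤ N.gain i z := by
    conv_lhs => rw [← graft_eq_of_mem_slice hv]
    exact le_iSup (fun v : N.feasible => ENNReal.ofReal (N.cost z - N.cost (N.graft i z v)))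
      ⟨v, hv.1⟩
  calc ENNReal.ofReal (N.cost z - N.blockMin i z)
      ≤ ENNReal.ofReal ((N.cost z - N.cost v) + η) :=
        ENNReal.ofReal_le_ofReal (by rw [blockMin]; linarith)
    _ ≤ ENNReal.ofReal (N.cost z - N.cost v) + ENNReal.ofReal η := ENNReal.ofReal_add_le
    _ ≤ N.gain i z + η := by rw [ENNReal.ofReal_coe_nnreal]; gcongr

theorem ofReal_expectedImprovement_le {P : Fin n → ℝ} (hP : ∀ i, 0 ≤ P i) {z : N.State}
    (hz : z ∈ N.feasible) :
    ENNReal.ofReal (N.expectedImprovement P z) ≤ ∑ i, ENNReal.ofReal (P i) * N.gain i z := by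
  rw [expectedImprovement, ENNReal.ofReal_sum_of_nonneg fun i _ =>
    mul_nonneg (sub_nonneg.2 (blockMin_le_cost i hz)) (hP i)]
  refine Finset.sum_le_sum fun i _ => ?_
  rw [mul_comm, ENNReal.ofReal_mul (hP i)]
  gcongr
  exact ofReal_sub_blockMin_le_gain hz

theorem isClosed_nearOptimal (ε : ℝ) : IsClosed (N.nearOptimal ε) :=
  isClosed_feasible.inter (isClosed_le N.continuous_cost continuous_const)

namespace IsAsyncRun

variable {Ω : Type*} {mΩ : MeasurableSpace Ω} {μ : Measure Ω} {ℱ : Filtration ℕ mΩ}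
  {P : Fin n → ℝ} {z₀ : N.State} {χ : ℕ → Ω → Fin n} {Z : ℕ → Ω → N.State} {ε : ℝ}

theorem feasible (h : N.IsAsyncRun μ ℱ P z₀ χ Z) (hz₀ : z₀ ∈ N.feasible) (t : ℕ) (ω : Ω) :
    Z t ω ∈ N.feasible := by
  cases t with
  | zero => rwa [h.init]
  | succ t => exact (h.step t ω).1.1

theorem cost_antitone (h : N.IsAsyncRun μ ℱ P z₀ χ Z) (hz₀ : z₀ ∈ N.feasible) (ω : Ω) :
    Antitone fun t => N.cost (Z t ω) :=
  antitone_nat_of_succ_le fun t => (h.step t ω).2 _ (mem_slice_self (h.feasible hz₀ t ω))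

theorem cost_le (h : N.IsAsyncRun μ ℱ P z₀ χ Z) (hz₀ : z₀ ∈ N.feasible) (t : ℕ) (ω : Ω) :
    N.cost (Z t ω) ≤ N.cost z₀ := by
  have := h.cost_antitone hz₀ ω t.zero_le
  rwa [← h.init ω]

/-- The cost never increases along a run, so near-optimality persists once reached. -/
theorem iterCount_le_iff (h : N.IsAsyncRun μ ℱ P z₀ χ Z) (hz₀ : z₀ ∈ N.feasible) (t : ℕ) (ω : Ω) :
    N.iterCount Z ε ω ≤ t ↔ Z t ω ∈ N.nearOptimal ε := by
  refine ⟨fun hK => ?_, fun ht => iInf₂_le t ht⟩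
  have hlt : N.iterCount Z ε ω < ((t + 1 : ℕ) : ℕ∞) :=
    hK.trans_lt (Nat.cast_lt.2 t.lt_succ_self)
  simp only [iterCount, iInf_lt_iff, Nat.cast_lt] at hlt
  obtain ⟨s, hs, hst⟩ := hlt
  exact ⟨h.feasible hz₀ t ω, (h.cost_antitone hz₀ ω (Nat.lt_succ_iff.1 hst)).trans hs.2⟩

theorem measurable_iterate (h : N.IsAsyncRun μ ℱ P z₀ χ Z) (t : ℕ) : Measurable (Z t) :=
  (h.measurable_Z t).mono (ℱ.le t) le_rfl

theorem measurableSet_nearOptimal (h : N.IsAsyncRun μ ℱ P z₀ χ Z) (t : ℕ) :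
    MeasurableSet {ω | Z t ω ∈ N.nearOptimal ε} :=
  h.measurable_iterate t (isClosed_nearOptimal ε).measurableSet

theorem measurable_iterCount (h : N.IsAsyncRun μ ℱ P z₀ χ Z) (hz₀ : z₀ ∈ N.feasible) :
    Measurable (N.iterCount Z ε) := by
  have hle : ∀ t : ℕ, MeasurableSet {ω | N.iterCount Z ε ω ≤ t} := fun t => by
    simpa only [h.iterCount_le_iff hz₀] using h.measurableSet_nearOptimal t
  have hnat : ∀ t : ℕ, MeasurableSet (N.iterCount Z ε ⁻¹' {(t : ℕ∞)}) := by
    intro t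
    cases t with
    | zero => simpa [Set.preimage] using hle 0
    | succ t =>
      convert (hle (t + 1)).diff (hle t) using 1
      ext ω
      have : (t : ℕ∞) < N.iterCount Z ε ω ↔ ((t + 1 : ℕ) : ℕ∞) ≤ N.iterCount Z ε ω := by
        rw [Nat.cast_succ, ENat.add_one_le_iff (ENat.natCast_ne_top t)]
      simp [this, le_antisymm_iff]
  refine measurable_to_countable' fun k => ?_
  induction k using ENat.recTopCoe with
  | coe t => exact hnat t
  | top =>
    convert (MeasurableSet.iUnion hle).compl using 1
    ext ω
    simp [ENat.eq_top_iff_forall_gt]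

/-- Away from near-optimality an iteration decreases the cost by `b_ε` at least, on average. -/
theorem mul_measure_le_lintegral (h : N.IsAsyncRun μ ℱ P z₀ χ Z) (hz₀ : z₀ ∈ N.feasible)
    (hP : ∀ i, 0 ≤ P i) (t : ℕ) :
    N.improvementBound P z₀ ε * μ {ω | Z t ω ∉ N.nearOptimal ε} ≤
      ∫⁻ ω, ENNReal.ofReal (N.cost (Z t ω) - N.cost (Z (t + 1) ω)) ∂μ := by
  have hset : MeasurableSet {ω | Z t ω ∉ N.nearOptimal ε} := (h.measurableSet_nearOptimal t).compl
  have hg : ∀ i, Measurable fun ω => N.gain i (Z t ω) :=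
    fun i => (measurable_gain i).comp (h.measurable_iterate t)
  have hχ : Measurable (χ (t + 1)) := (h.measurable_χ t).mono (ℱ.le _) le_rfl
  have hχi : ∀ i, MeasurableSet {ω | χ (t + 1) ω = i} := fun i => hχ (measurableSet_singleton i)
  calc N.improvementBound P z₀ ε * μ {ω | Z t ω ∉ N.nearOptimal ε}
      = ∫⁻ ω, {ω | Z t ω ∉ N.nearOptimal ε}.indicator
          (fun _ => N.improvementBound P z₀ ε) ω ∂μ := (lintegral_indicator_const hset _).symm
    _ ≤ ∫⁻ ω, ∑ i, ENNReal.ofReal (P i) * N.gain i (Z t ω) ∂μ := by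
        refine lintegral_mono (Set.indicator_le fun ω hω => ?_)
        exact (iInf₂_le _ ⟨h.feasible hz₀ t ω, hω, h.cost_le hz₀ t ω⟩).trans
          (ofReal_expectedImprovement_le hP (h.feasible hz₀ t ω))
    _ = ∑ i, ENNReal.ofReal (P i) * ∫⁻ ω, N.gain i (Z t ω) ∂μ := by
        rw [lintegral_finsetSum _ fun i _ => (hg i).const_mul _]
        exact Finset.sum_congr rfl fun i _ => lintegral_const_mul _ (hg i)
    _ = ∑ i, ∫⁻ ω, {ω | χ (t + 1) ω = i}.indicator 1 ω * N.gain i (Z t ω) ∂μ := by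
        refine Finset.sum_congr rfl fun i _ => ?_
        -- The wake-up indicator is independent of `ℱ t`, which already determines `Z t`, so the
        -- integral of the product factorizes.
        have hind : Measurable[MeasurableSpace.comap (χ (t + 1)) inferInstance]
            ({ω | χ (t + 1) ω = i}.indicator (1 : Ω → ℝ≥0∞)) :=
          (measurable_of_finite (({i} : Set (Fin n)).indicator 1)).comp (comap_measurable _)
        rw [← h.law t i, ← lintegral_indicator_one (hχi i)]
        exact (lintegral_mul_eq_lintegral_mul_lintegral_of_independent_measurableSpace
          (Mf := MeasurableSpace.comap (χ (t + 1)) inferInstance) (Mg := ℱ t)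
          hχ.comap_le (ℱ.le t) (h.indep t) hind
          ((measurable_gain i).comp (h.measurable_Z t))).symm
    _ = ∫⁻ ω, ∑ i, {ω | χ (t + 1) ω = i}.indicator 1 ω * N.gain i (Z t ω) ∂μ :=
        (lintegral_finsetSum _ fun i _ => (measurable_one.indicator (hχi i)).mul (hg i)).symm
    _ ≤ ∫⁻ ω, ENNReal.ofReal (N.cost (Z t ω) - N.cost (Z (t + 1) ω)) ∂μ := by
        -- Only the summand `i = χ (t + 1) ω` survives, and the update realizes at least its gain.
        refine lintegral_mono fun ω => ?_
        simpa [Set.indicator_apply] using gain_le (h.feasible hz₀ t ω) (h.step t ω)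

theorem sum_mul_measure_le [IsProbabilityMeasure μ] (h : N.IsAsyncRun μ ℱ P z₀ χ Z)
    (hz₀ : z₀ ∈ N.feasible) (hP : ∀ i, 0 ≤ P i) (T : ℕ) :
    ∑ t ∈ Finset.range T, N.improvementBound P z₀ ε * μ {ω | Z t ω ∉ N.nearOptimal ε} ≤
      ENNReal.ofReal (N.cost z₀ - N.optValue) := by
  have hc : ∀ t, Measurable fun ω => N.cost (Z t ω) :=
    fun t => N.continuous_cost.measurable.comp (h.measurable_iterate t)
  calc _ ≤ ∑ t ∈ Finset.range T,
          ∫⁻ ω, ENNReal.ofReal (N.cost (Z t ω) - N.cost (Z (t + 1) ω)) ∂μ :=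
        Finset.sum_le_sum fun t _ => h.mul_measure_le_lintegral hz₀ hP t
    _ = ∫⁻ ω, ∑ t ∈ Finset.range T,
          ENNReal.ofReal (N.cost (Z t ω) - N.cost (Z (t + 1) ω)) ∂μ :=
        (lintegral_finsetSum _ fun t _ => ((hc t).sub (hc (t + 1))).ennreal_ofReal).symm
    _ ≤ ∫⁻ _, ENNReal.ofReal (N.cost z₀ - N.optValue) ∂μ := by
        refine lintegral_mono fun ω => ?_
        rw [← ENNReal.ofReal_sum_of_nonneg fun t _ =>
          sub_nonneg.2 (h.cost_antitone hz₀ ω t.le_succ), Finset.sum_range_sub', h.init]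
        exact ENNReal.ofReal_le_ofReal (sub_le_sub_left (optValue_le (h.feasible hz₀ T ω)) _)
    _ = _ := by simp

/-- Every time before `K_ε` contributes 1 to the sum. Testing against finite `k ≤ K_ε` also settles
`K_ε = ⊤`. -/
theorem iterCount_le_tsum (h : N.IsAsyncRun μ ℱ P z₀ χ Z) (hz₀ : z₀ ∈ N.feasible) (ω : Ω) :
    (N.iterCount Z ε ω : ℝ≥0∞) ≤
      ∑' t, {ω | Z t ω ∉ N.nearOptimal ε}.indicator (1 : Ω → ℝ≥0∞) ω := by
  have key : ∀ k : ℕ, (k : ℕ∞) ≤ N.iterCount Z ε ω →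
      (k : ℝ≥0∞) ≤ ∑' t, {ω | Z t ω ∉ N.nearOptimal ε}.indicator (1 : Ω → ℝ≥0∞) ω := by
    intro k hk
    refine le_trans (le_of_eq ?_) (ENNReal.sum_le_tsum (Finset.range k))
    rw [Finset.sum_congr rfl (g := fun _ => 1), Finset.sum_const, Finset.card_range, nsmul_one]
    intro t ht
    refine Set.indicator_of_mem (s := {ω | Z t ω ∉ N.nearOptimal ε}) (fun hmem => ?_) _
    have := hk.trans ((h.iterCount_le_iff hz₀ t ω).2 hmem)
    exact absurd (Nat.cast_le.1 this) (not_le.2 (Finset.mem_range.1 ht))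
  cases hK : N.iterCount Z ε ω using ENat.recTopCoe with
  | top =>
    refine le_top.trans (ENNReal.eq_top_of_forall_nnreal_le fun r => ?_).ge
    obtain ⟨k, hk⟩ := exists_nat_ge r
    exact le_trans (by exact_mod_cast hk) (key k (by simp [hK]))
  | coe k => exact key k hK.ge

theorem lintegral_iterCount_le [IsProbabilityMeasure μ] (h : N.IsAsyncRun μ ℱ P z₀ χ Z)
    (hz₀ : z₀ ∈ N.feasible) (hP : ∀ i, 0 ≤ P i) (hb : 0 < N.improvementBound P z₀ ε) :
    ∫⁻ ω, (N.iterCount Z ε ω : ℝ≥0∞) ∂μ ≤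
      ENNReal.ofReal (N.cost z₀ - N.optValue) / N.improvementBound P z₀ ε := by
  have hset : ∀ t, MeasurableSet {ω | Z t ω ∉ N.nearOptimal ε} :=
    fun t => (h.measurableSet_nearOptimal t).compl
  -- `b_ε = ⊤` is possible, namely when `z₀` is already near-optimal; the finite numerator makes the
  -- rewriting valid there too.
  rw [ENNReal.le_div_iff_mul_le (.inl hb.ne') (.inr ENNReal.ofReal_ne_top)]
  calc _ ≤ (∫⁻ ω, ∑' t, {ω | Z t ω ∉ N.nearOptimal ε}.indicator (1 : Ω → ℝ≥0∞) ω ∂μ) *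
          N.improvementBound P z₀ ε := by
        gcongr with ω
        exact h.iterCount_le_tsum hz₀ ω
    _ = ∑' t, N.improvementBound P z₀ ε * μ {ω | Z t ω ∉ N.nearOptimal ε} := by
        rw [lintegral_tsum fun t => (measurable_one.indicator (hset t)).aemeasurable, mul_comm,
          ENNReal.tsum_mul_left]
        simp only [lintegral_indicator_one (hset _)]
    _ ≤ _ := ENNReal.tsum_le_of_sum_range_le fun T => h.sum_mul_measure_le hz₀ hP T

end IsAsyncRun

end

end LocNetwork

theorem theorem2 {n m p : ℕ} (N : LocNetwork n m p)
    (hconn : N.G.Connected) (hanchor : ∃ i, (N.anchorsOf i).Nonempty)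
    (P : Fin n → ℝ) (hP : ∀ i, 0 < P i)
    (z₀ : N.State) (hz₀ : z₀ ∈ N.feasible) (ε : ℝ) (hε : 0 < ε) :
    0 < N.improvementBound P z₀ ε ∧
    (N.optValue + ε < N.cost z₀ → N.improvementBound P z₀ ε < ⊤) ∧
    ∀ {Ω : Type*} {mΩ : MeasurableSpace Ω} (μ : Measure Ω) [IsProbabilityMeasure μ]
      (ℱ : Filtration ℕ mΩ) (χ : ℕ → Ω → Fin n) (Z : ℕ → Ω → N.State),
      N.IsAsyncRun μ ℱ P z₀ χ Z →
        Measurable (N.iterCount Z ε) ∧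
        (∀ᵐ ω ∂μ, N.iterCount Z ε ω < ⊤) ∧
        (∀ ω (t : ℕ), N.iterCount Z ε ω ≤ t → Z t ω ∈ N.nearOptimal ε) ∧
        ∫⁻ ω, (N.iterCount Z ε ω : ℝ≥0∞) ∂μ < ⊤ ∧
        ∫⁻ ω, (N.iterCount Z ε ω : ℝ≥0∞) ∂μ ≤
          ENNReal.ofReal (N.cost z₀ - N.optValue) / N.improvementBound P z₀ ε := by
  have hb := LocNetwork.improvementBound_pos hconn hanchor hP z₀ hε
  refine ⟨hb, LocNetwork.improvementBound_lt_top hz₀, fun μ _ ℱ χ Z h => ?_⟩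
  have hmeas := h.measurable_iterCount hz₀ (ε := ε)
  have hle := h.lintegral_iterCount_le hz₀ (fun i => (hP i).le) hb
  have hfin := hle.trans_lt (ENNReal.div_lt_top ENNReal.ofReal_ne_top hb.ne')
  refine ⟨hmeas, ?_, fun ω t => (h.iterCount_le_iff hz₀ t ω).1, hfin, hle⟩
  have hmeas' : Measurable fun ω => (N.iterCount Z ε ω : ℝ≥0∞) :=
    (measurable_from_top (f := ENat.toENNReal)).comp hmeas
  filter_upwards [ae_lt_top hmeas' hfin.ne] with ω hω
  simpa using hω
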